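/- Let $G$ be a finite simple connected graph and $K$ a field. Let $K[E(G)]$ be the polynomial ring whose variables are the edges of $G$; to an edge $e=\{u,v\}$ attach the vector $a_e=u+v$ in the free abelian group on $V(G)$, and let $I_G\subset K[E(G)]$ be the toric ideal generated by all differences $\prod_e e^{m_e}-\prod_e e^{n_e}$ of monomials with $\sum_e m_e a_e=\sum_e n_e a_e$. For an even closed walk $w=(e_1,e_2,\dots,e_{2q})$ of $G$ put $B_w=\prod_{k=1}^{q}e_{2k-1}-\prod_{k=1}^{q}e_{2k}$, let $V(w)$ and $E(w)$ be the sets of vertices and edges that occur in $w$, and let $G_w$ be the subgraph of $G$ induced on $V(w)$. * A binomial is a difference of two distinct monomials, and its support is the set of variables occurring in it. The binomial $B_w$ is *fundamental* if $B_w\neq 0$ and $B_{w'}\in\langle B_w\rangle$ for every even closed walk $w'$ of $G_w$. * $w$ is a *circuit* if $B_w$ is a circuit of $I_G$, that is, $B_w$ is an irreducible polynomial and a binomial, and no binomial of $I_G$ has support strictly contained in the support of $B_w$. * A *chord* of $w$ is an edge of $G_w$ that is not in $E(w)$. A chord of a cycle $w$ of even length is *even* (respectively *odd*) if it breaks the cycle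 into two even (respectively two odd) cycles. **Theorem.** Let $w$ be an even closed walk of $G$. Then $B_w$ is fundamental if and only if $w$ is a circuit and either $w$ has no chords, or $w$ is a cycle with no even chords and at most one odd chord. -/

import Mathlib

namespace ToricGraph

noncomputable section

/-- A binomial: a difference of two distinct monomials (in particular it is not zero). -/
def IsBinomial {ι K : Type*} [Field K] (p : MvPolynomial ι K) : Prop :=
  ∃ u v : ι →₀ ℕ, u ≠ v ∧ p = MvPolynomial.monomial u 1 - MvPolynomial.monomial v 1

/-- The `A`-degree `∑ᵢ uᵢ aᵢ` of the monomial with exponent `u`, for a configuration `a`. -/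
def aDegree {ι M : Type*} [AddCommMonoid M] (a : ι → M) (u : ι →₀ ℕ) : M :=
  u.sum fun i k => k • a i

/-- The toric ideal of a configuration `a`: it is generated by all differences of two monomials
of the same `A`-degree. -/
def toricIdeal (K : Type*) {ι M : Type*} [Field K] [AddCommMonoid M] (a : ι → M) :
    Ideal (MvPolynomial ι K) :=
  Ideal.span {p | ∃ u v : ι →₀ ℕ, aDegree a u = aDegree a v ∧
    p = MvPolynomial.monomial u 1 - MvPolynomial.monomial v 1}

/-- A circuit of an ideal `I`: an irreducible binomial of `I` whose support (the set of variables
that occur in it) is minimal among the supports of the binomials of `I`. -/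
def IsCircuit {ι K : Type*} [Field K] (I : Ideal (MvPolynomial ι K)) (B : MvPolynomial ι K) :
    Prop :=
  IsBinomial B ∧ B ∈ I ∧ Irreducible B ∧
    ∀ B' : MvPolynomial ι K, IsBinomial B' → B' ∈ I → ¬ B'.vars ⊂ B.vars

/-- The vector `v + u` attached to the edge `{v, u}`, in the free abelian group on the vertices. -/
def edgeVector {V : Type*} : Sym2 V → (V →₀ ℤ) :=
  Sym2.lift ⟨fun v u => Finsupp.single v 1 + Finsupp.single u 1, fun _ _ => add_comm _ _⟩

/-- The toric ideal `I_G` of a graph, in the polynomial ring whose variables are the edges. -/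
def graphIdeal (K : Type*) {V : Type*} [Field K] (G : SimpleGraph V) :
    Ideal (MvPolynomial G.edgeSet K) :=
  toricIdeal K fun e : G.edgeSet => edgeVector (e : Sym2 V)

/-- The entries of a list in positions 1, 3, 5, … (counted from 1). -/
def oddPart {α : Type*} : List α → List α
  | [] => []
  | [a] => [a]
  | a :: _ :: l => a :: oddPart l

/-- The entries of a list in positions 2, 4, 6, … (counted from 1). -/
def evenPart {α : Type*} (l : List α) : List α := oddPart l.tail

variable {V : Type*} {G : SimpleGraph V}

/-- The sequence of edges of a walk, as elements of the edge set of the graph. -/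
def edgeList {u v : V} (w : G.Walk u v) : List G.edgeSet :=
  w.darts.map fun d => ⟨d.edge, d.edge_mem⟩

/-- The binomial `B_w = E⁺(w) - E⁻(w)`: the product of the edges in odd positions minus the
product of the edges in even positions. -/
def walkBinomial (K : Type*) [Field K] {u v : V} (w : G.Walk u v) : MvPolynomial G.edgeSet K :=
  ((oddPart (edgeList w)).map MvPolynomial.X).prod -
    ((evenPart (edgeList w)).map MvPolynomial.X).prod

/-- `w` is fundamental: `B_{w'}` lies in the ideal generated by `B_w` for every even closed walk
`w'` of the subgraph `G_w` of `G` induced on the vertices of `w` (that is, for every even closed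
walk of `G` all of whose vertices are vertices of `w`). -/
def IsFundamentalWalk (K : Type*) [Field K] {v : V} (w : G.Walk v v) : Prop :=
  ∀ (x : V) (w' : G.Walk x x), Even w'.length → (∀ y ∈ w'.support, y ∈ w.support) →
    walkBinomial K w' ∈ Ideal.span {walkBinomial K w}

/-- The binomial `B_w` is fundamental: it is a genuine (nonzero) binomial, and `w` is a
fundamental walk. -/
def IsFundamentalBinomial (K : Type*) [Field K] {v : V} (w : G.Walk v v) : Prop :=
  walkBinomial K w ≠ 0 ∧ IsFundamentalWalk K w

/-- A chord of `w`: an edge of `G` between vertices of `w` that is not an edge of `w`. -/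
def IsChord {v : V} (w : G.Walk v v) (f : Sym2 V) : Prop :=
  f ∈ G.edgeSet ∧ (∀ x ∈ f, x ∈ w.support) ∧ f ∉ w.edges

/-- An even chord of a cycle `w = (v₀, v₁, …, v_L = v₀)`: a chord `f = {vᵢ, vⱼ}`, `i < j < L`, that
breaks `w` in the two even closed walks `(vᵢ, vᵢ₊₁, …, vⱼ, vᵢ)`, which has `j - i + 1` edges, and
`(v₀, …, vᵢ, vⱼ, …, v_L)`, which has `i + 1 + (L - j)` edges.
(A cycle is a single block, so no chord of it joins two different blocks.) -/
def IsEvenChordOfCycle {v : V} (w : G.Walk v v) (f : Sym2 V) : Prop :=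
  w.IsCycle ∧ IsChord w f ∧ ∃ i j : ℕ, i < j ∧ j < w.length ∧
    f = s(w.getVert i, w.getVert j) ∧ Even (j - i + 1) ∧ Even (i + 1 + (w.length - j))

/-- An odd chord of a cycle: a chord that breaks it in two odd closed walks. -/
def IsOddChordOfCycle {v : V} (w : G.Walk v v) (f : Sym2 V) : Prop :=
  w.IsCycle ∧ IsChord w f ∧ ∃ i j : ℕ, i < j ∧ j < w.length ∧
    f = s(w.getVert i, w.getVert j) ∧ Odd (j - i + 1) ∧ Odd (i + 1 + (w.length - j))

end

end ToricGraph

namespace ToricGraph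

open MvPolynomial

noncomputable section

/-! Everything is read off in the lattice of integer vectors on the edges. An even closed walk gives
its alternating sum `altSum w`, a vector in the kernel of `boundary`. If the monomials of `B_w` are
coprime, a binomial lies in `⟨B_w⟩` exactly when its exponent difference is an integer multiple of
`altSum w`. The even closed walks of a connected graph span the kernel (`mem_of_boundary_eq_zero`),
so being fundamental means that `altSum w` generates the lattice of `G_w`.

If `B_w` is fundamental, coprimality comes from `exists_disjoint_walk`, and rank one of the lattice
gives primality and minimal support. A chord `f` joined to the base vertex along `w` gives a closed
walk using `f` once. This walk is odd, since an even one would put `f` in the support of a multiple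
of `altSum w`. Composing two odd walks then shows that every closed walk at the base of `w`, inside
`G_w` and avoiding `f`, is even. Hence there is no second chord, and no proper closed subwalk: it
would be even, and comparing lengths shows that its alternating sum is not a multiple of `altSum w`.
So `w` is a cycle.

Conversely, for a circuit the kernel vectors supported on `E(w)` are multiples of `altSum w`
(`IsCircuit.mem_zmultiples`): minimal support gives proportionality, irreducibility gives
primitivity. It remains to see that kernel vectors on `G_w` vanish at chords. For a unique odd chord
of an even cycle, pair with alternating signs on the vertices. -/

/-- The inclusion of exponent vectors in the lattice of integer vectors. -/
def castInt {ι : Type*} : (ι →₀ ℕ) →+ (ι →₀ ℤ) :=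
  Finsupp.mapRange.addMonoidHom (Nat.castAddMonoidHom ℤ)

@[simp] lemma castInt_apply {ι : Type*} (u : ι →₀ ℕ) (i : ι) : castInt u i = (u i : ℤ) := rfl

@[simp] lemma castInt_single {ι : Type*} (i : ι) (n : ℕ) :
    castInt (Finsupp.single i n) = Finsupp.single i (n : ℤ) := by
  simp [castInt]

lemma castInt_injective {ι : Type*} : Function.Injective (castInt (ι := ι)) := by
  intro u v h
  ext i
  have := DFunLike.congr_fun h i
  simpa using this

lemma eq_zero_or_eq_zero_of_disjoint {ι : Type*} {a b : ι →₀ ℕ}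
    (h : Disjoint a.support b.support) (i : ι) : a i = 0 ∨ b i = 0 := by
  by_contra! hcon
  exact Finset.disjoint_left.1 h (Finsupp.mem_support_iff.2 hcon.1)
    (Finsupp.mem_support_iff.2 hcon.2)

lemma single_add_tsub_single {ι : Type*} {a : ι →₀ ℕ} {i : ι} (h : a i ≠ 0) :
    Finsupp.single i 1 + (a - Finsupp.single i 1) = a := by
  refine add_tsub_cancel_of_le ?_
  rw [Finsupp.single_le_iff]
  omega

/-- The positive part of an integer vector. -/
def posVec {ι : Type*} (γ : ι →₀ ℤ) : ι →₀ ℕ := γ.mapRange Int.toNat rfl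

@[simp] lemma posVec_apply {ι : Type*} (γ : ι →₀ ℤ) (i : ι) : posVec γ i = (γ i).toNat := rfl

lemma castInt_posVec_sub {ι : Type*} (γ : ι →₀ ℤ) :
    castInt (posVec γ) - castInt (posVec (-γ)) = γ := by
  ext i
  simp

lemma posVec_disjoint {ι : Type*} (γ : ι →₀ ℤ) :
    Disjoint (posVec γ).support (posVec (-γ)).support := by
  rw [Finset.disjoint_left]
  intro i hi hj
  simp at hi hj
  omega

/-! ### Principal binomial ideals and exponent lattices -/

/-- The difference of two monomials. -/
def binom (K : Type*) {ι : Type*} [Field K] (u v : ι →₀ ℕ) : MvPolynomial ι K :=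
  monomial u 1 - monomial v 1

section Binom

variable {K ι M : Type*} [Field K] [AddCommGroup M]

/-- The `K`-algebra map to a group algebra given by a grading of the monomials. -/
def gradeHom (K : Type*) [Field K] (D : (ι →₀ ℕ) →+ M) :
    MvPolynomial ι K →+* AddMonoidAlgebra K M :=
  AddMonoidAlgebra.mapDomainRingHom K D

lemma gradeHom_monomial (D : (ι →₀ ℕ) →+ M) (u : ι →₀ ℕ) (c : K) :
    gradeHom K D (monomial u c) = AddMonoidAlgebra.single (D u) c :=
  AddMonoidAlgebra.mapDomain_single

lemma gradeHom_binom_eq_zero_iff (D : (ι →₀ ℕ) →+ M) (u v : ι →₀ ℕ) :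
    gradeHom K D (binom K u v) = 0 ↔ D u = D v := by
  rw [binom, map_sub, gradeHom_monomial, gradeHom_monomial, sub_eq_zero]
  constructor
  · intro h
    have := congrArg AddMonoidAlgebra.coeff h
    simpa [Finsupp.single_eq_single_iff] using this
  · intro h
    rw [h]

lemma binom_ne_zero_iff (u v : ι →₀ ℕ) : binom K u v ≠ 0 ↔ u ≠ v := by
  rw [binom, sub_ne_zero, not_iff_not, monomial_left_inj one_ne_zero]

lemma vars_binom [DecidableEq ι] {u v : ι →₀ ℕ} (h : u ≠ v) :
    (binom K u v).vars = u.support ∪ v.support := by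
  classical
  ext i
  rw [mem_vars_iff_mem_support]
  simp only [mem_support_iff, Finset.mem_union]
  constructor
  · rintro ⟨d, hd, hi⟩
    by_cases h1 : u = d
    · subst h1; exact Or.inl hi
    · by_cases h2 : v = d
      · subst h2; exact Or.inr hi
      · exact absurd (by simp [binom, coeff_monomial, h1, h2]) hd
  · rintro (hi | hi)
    · exact ⟨u, by simp [binom, coeff_monomial, h.symm], hi⟩
    · exact ⟨v, by simp [binom, coeff_monomial, h], hi⟩

/-- Grading by `ℤ^ι` modulo the span of `a - b` kills the generator, hence the whole ideal.
Coprimality is not needed in this direction. -/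
lemma sub_mem_zmultiples_of_binom_mem {a b u v : ι →₀ ℕ}
    (h : binom K u v ∈ Ideal.span {binom K a b}) :
    castInt u - castInt v ∈ AddSubgroup.zmultiples (castInt a - castInt b) := by
  let Q := (ι →₀ ℤ) ⧸ AddSubgroup.zmultiples (castInt a - castInt b)
  let D : (ι →₀ ℕ) →+ Q := (QuotientAddGroup.mk' _).comp castInt
  have hD : ∀ x y, D x = D y ↔
      castInt x - castInt y ∈ AddSubgroup.zmultiples (castInt a - castInt b) := by
    intro x y
    rw [← sub_eq_zero]
    simp only [D, AddMonoidHom.comp_apply, ← map_sub]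
    exact QuotientAddGroup.eq_zero_iff _
  rw [← hD, ← gradeHom_binom_eq_zero_iff (K := K)]
  obtain ⟨q, hq⟩ := Ideal.mem_span_singleton'.1 h
  rw [← hq, map_mul, (gradeHom_binom_eq_zero_iff D a b).2, mul_zero]
  rw [hD]
  exact AddSubgroup.mem_zmultiples _

lemma binom_swap (u v : ι →₀ ℕ) : binom K u v = - binom K v u := by
  simp [binom]

lemma binom_add_left (c u v : ι →₀ ℕ) :
    binom K (c + u) (c + v) = monomial c 1 * binom K u v := by
  simp [binom, mul_sub, monomial_mul]

lemma binom_dvd_binom_nsmul (a b : ι →₀ ℕ) (n : ℕ) :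
    binom K a b ∣ binom K (n • a) (n • b) := by
  have := sub_dvd_pow_sub_pow (monomial a (1 : K)) (monomial b 1) n
  simpa [binom, monomial_pow] using this

/-- Coprimality forces `n • a ≤ u`. After removing a common monomial, what remains is a difference
of `n`-th powers. -/
lemma binom_dvd_of_eq_nsmul {a b u v : ι →₀ ℕ} (hab : Disjoint a.support b.support) (n : ℕ)
    (h : castInt u - castInt v = n • (castInt a - castInt b)) :
    binom K a b ∣ binom K u v := by
  have h' : ∀ i, (u i : ℤ) - v i = n * (a i - b i) := fun i => by
    simpa using DFunLike.congr_fun h i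
  have hle : ∀ i, n * a i ≤ u i := fun i => by
    have := h' i
    rcases eq_zero_or_eq_zero_of_disjoint hab i with h0 | h0
    · simp [h0]
    · rw [h0] at this
      zify
      push_cast at this
      linarith [Int.natCast_nonneg (v i)]
  obtain ⟨c, rfl⟩ : ∃ c, u = c + n • a := by
    refine ⟨u - n • a, ?_⟩
    ext i
    have := hle i
    simp only [Finsupp.coe_add, Finsupp.coe_tsub, Finsupp.coe_smul, Pi.add_apply, Pi.sub_apply,
      Pi.smul_apply, smul_eq_mul]
    omega
  obtain rfl : v = c + n • b := by
    ext i
    have := h' i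
    simp only [Finsupp.coe_add, Finsupp.coe_smul, Pi.add_apply, Pi.smul_apply, smul_eq_mul] at *
    zify
    push_cast at this
    linarith
  rw [binom_add_left]
  exact Dvd.dvd.mul_left (binom_dvd_binom_nsmul a b n) _

lemma binom_mem_of_sub_mem_zmultiples {a b u v : ι →₀ ℕ}
    (hab : Disjoint a.support b.support)
    (h : castInt u - castInt v ∈ AddSubgroup.zmultiples (castInt a - castInt b)) :
    binom K u v ∈ Ideal.span {binom K a b} := by
  rw [Ideal.mem_span_singleton]
  obtain ⟨k, hk⟩ := AddSubgroup.mem_zmultiples_iff.1 h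
  obtain ⟨n, rfl | rfl⟩ := k.eq_nat_or_neg
  · exact binom_dvd_of_eq_nsmul hab n (by rw [← hk, natCast_zsmul])
  · rw [binom_swap u v, dvd_neg]
    refine binom_dvd_of_eq_nsmul hab n ?_
    rw [neg_smul, natCast_zsmul] at hk
    rw [← neg_sub (castInt u), ← hk, neg_neg]

lemma not_isUnit_binom (u v : ι →₀ ℕ) : ¬ IsUnit (binom K u v) := by
  intro h
  have := h.map (MvPolynomial.eval (fun _ : ι => (1 : K)))
  simp [binom, eval_monomial] at this

/-- A binomial which generates all binomials that vanish in a torsion-free grading is prime. -/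
lemma prime_binom [TwoUniqueSums M] (D : (ι →₀ ℕ) →+ M) {a b : ι →₀ ℕ} (hne : a ≠ b)
    (hD : D a = D b) (h : ∀ u v, D u = D v → binom K u v ∈ Ideal.span {binom K a b}) :
    Prime (binom K a b) := by
  have hker : Ideal.span {binom K a b} = RingHom.ker (gradeHom K D) := by
    apply le_antisymm
    · rw [Ideal.span_singleton_le_iff_mem, RingHom.mem_ker, gradeHom_binom_eq_zero_iff, hD]
    · intro p hp
      -- Choosing one monomial in each degree gives an additive section; `p` differs from the
      -- section of its image by combinations of homogeneous binomials.
      let s : AddMonoidAlgebra K M → MvPolynomial ι K :=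
        AddMonoidAlgebra.mapDomain (Function.invFun D)
      have key : ∀ p : MvPolynomial ι K,
          p - s (gradeHom K D p) ∈ Ideal.span {binom K a b} := by
        intro p
        induction p using MvPolynomial.induction_on' with
        | monomial u c =>
          have h1 : s (gradeHom K D (monomial u c)) = monomial (Function.invFun D (D u)) c := by
            rw [gradeHom_monomial]
            exact AddMonoidAlgebra.mapDomain_single
          have h2 : monomial u c - monomial (Function.invFun D (D u)) c =
              C c * binom K u (Function.invFun D (D u)) := by
            simp [binom, mul_sub, C_mul_monomial]
          rw [h1, h2]
          refine Ideal.mul_mem_left _ _ (h _ _ ?_)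
          exact (Function.invFun_eq ⟨u, rfl⟩).symm
        | add p q hp hq =>
          have h1 : s (gradeHom K D (p + q)) = s (gradeHom K D p) + s (gradeHom K D q) := by
            rw [map_add]
            exact AddMonoidAlgebra.mapDomain_add _ _ _
          rw [h1, add_sub_add_comm]
          exact Ideal.add_mem _ hp hq
      have hs : s 0 = 0 := AddMonoidAlgebra.mapDomain_zero _
      have := key p
      rwa [(RingHom.mem_ker).1 hp, hs, sub_zero] at this
  rw [← Ideal.span_singleton_prime ((binom_ne_zero_iff a b).2 hne), hker]
  -- The group algebra is a domain because `M` has `TwoUniqueSums`.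
  exact RingHom.ker_isPrime _

end Binom

open SimpleGraph

/-! ### Alternating sums of walks and the lattice of a graph -/

section Walks

variable {V : Type*} {G : SimpleGraph V}

/-- An edge of the graph, given by two adjacent vertices. -/
def edgeOf {u v : V} (h : G.Adj u v) : G.edgeSet := ⟨s(u, v), h⟩

lemma edgeOf_symm {u v : V} (h : G.Adj u v) : edgeOf h.symm = edgeOf h :=
  Subtype.ext Sym2.eq_swap

/-- The alternating sum of the edges of a walk. -/
def altSum : ∀ {u v : V}, G.Walk u v → (G.edgeSet →₀ ℤ)
  | _, _, .nil => 0
  | _, _, .cons h p => Finsupp.single (edgeOf h) 1 - altSum p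

@[simp] lemma altSum_nil {u : V} : altSum (.nil : G.Walk u u) = 0 := rfl

@[simp] lemma altSum_cons {u v x : V} (h : G.Adj u v) (p : G.Walk v x) :
    altSum (.cons h p) = Finsupp.single (edgeOf h) 1 - altSum p := rfl

lemma altSum_append {u v x : V} (p : G.Walk u v) (q : G.Walk v x) :
    altSum (p.append q) = altSum p + (-1 : ℤ) ^ p.length • altSum q := by
  induction p with
  | nil => simp
  | cons h p ih =>
    simp only [Walk.cons_append, altSum_cons, ih, Walk.length_cons, pow_succ]
    module

lemma altSum_reverse {u v : V} (p : G.Walk u v) :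
    altSum p.reverse = (-1 : ℤ) ^ (p.length + 1) • altSum p := by
  induction p with
  | nil => simp
  | cons h p ih =>
    simp only [Walk.reverse_cons, altSum_append, altSum_cons, ih, Walk.length_cons, pow_succ,
      Walk.length_reverse, altSum_nil, edgeOf_symm h]
    module

/-- The degree of an integer vector on the edges. -/
def boundary : (G.edgeSet →₀ ℤ) →ₗ[ℤ] (V →₀ ℤ) :=
  Finsupp.linearCombination ℤ fun e : G.edgeSet => edgeVector (e : Sym2 V)

lemma boundary_single {u v : V} (h : G.Adj u v) (n : ℤ) :
    boundary (Finsupp.single (edgeOf h) n) =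
      n • (Finsupp.single u (1 : ℤ) + Finsupp.single v (1 : ℤ)) := by
  rw [boundary, Finsupp.linearCombination_single]
  rfl

/-- Consecutive edges have opposite signs, so the inner vertices cancel. -/
lemma boundary_altSum {u v : V} (p : G.Walk u v) :
    boundary (altSum p) =
      Finsupp.single u (1 : ℤ) - (-1 : ℤ) ^ p.length • Finsupp.single v (1 : ℤ) := by
  induction p with
  | nil => simp
  | cons h p ih =>
    simp only [altSum_cons, map_sub, boundary_single, ih, Walk.length_cons, pow_succ]
    module

lemma boundary_altSum_of_even {v : V} (p : G.Walk v v) (hp : Even p.length) :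
    boundary (altSum p) = 0 := by
  simp [boundary_altSum, hp.neg_one_pow]

/-- The exponent vector of the product of the edges in odd positions. -/
def oddExp {u v : V} (w : G.Walk u v) : G.edgeSet →₀ ℕ :=
  ((oddPart (edgeList w)).map fun e => Finsupp.single e 1).sum

/-- The exponent vector of the product of the edges in even positions. -/
def evenExp {u v : V} (w : G.Walk u v) : G.edgeSet →₀ ℕ :=
  ((evenPart (edgeList w)).map fun e => Finsupp.single e 1).sum

lemma oddPart_cons {α : Type*} (a : α) (l : List α) : oddPart (a :: l) = a :: evenPart l := by
  cases l <;> rfl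

@[simp] lemma oddExp_nil {u : V} : oddExp (.nil : G.Walk u u) = 0 := rfl

@[simp] lemma evenExp_nil {u : V} : evenExp (.nil : G.Walk u u) = 0 := rfl

lemma edgeList_cons {u v x : V} (h : G.Adj u v) (p : G.Walk v x) :
    edgeList (.cons h p) = edgeOf h :: edgeList p := rfl

@[simp] lemma oddExp_cons {u v x : V} (h : G.Adj u v) (p : G.Walk v x) :
    oddExp (.cons h p) = Finsupp.single (edgeOf h) 1 + evenExp p := by
  rw [oddExp, edgeList_cons, oddPart_cons, List.map_cons, List.sum_cons, evenExp]

@[simp] lemma evenExp_cons {u v x : V} (h : G.Adj u v) (p : G.Walk v x) :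
    evenExp (.cons h p) = oddExp p := rfl

lemma castInt_oddExp_sub {u v : V} (w : G.Walk u v) :
    castInt (oddExp w) - castInt (evenExp w) = altSum w := by
  induction w with
  | nil => simp
  | cons h p ih =>
    rw [oddExp_cons, evenExp_cons, altSum_cons, ← ih, map_add, castInt_single]
    simp only [Nat.cast_one]
    abel

lemma prod_map_X {ι K : Type*} [Field K] (l : List ι) :
    (l.map (MvPolynomial.X (R := K))).prod =
      MvPolynomial.monomial (l.map fun e => Finsupp.single e 1).sum 1 := by
  induction l with
  | nil => rfl
  | cons a l ih => simp [ih, MvPolynomial.X, MvPolynomial.monomial_mul]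

lemma walkBinomial_eq (K : Type*) [Field K] {u v : V} (w : G.Walk u v) :
    walkBinomial K w = binom K (oddExp w) (evenExp w) := by
  rw [walkBinomial, prod_map_X, prod_map_X]
  rfl

lemma oddExp_ne_evenExp_iff {u v : V} (w : G.Walk u v) :
    oddExp w ≠ evenExp w ↔ altSum w ≠ 0 := by
  rw [← castInt_oddExp_sub, sub_ne_zero, castInt_injective.ne_iff]

lemma mem_edges_iff {u v : V} (w : G.Walk u v) (e : G.edgeSet) :
    (e : Sym2 V) ∈ w.edges ↔ oddExp w e ≠ 0 ∨ evenExp w e ≠ 0 := by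
  classical
  induction w with
  | nil => simp
  | cons h p ih =>
    rw [Walk.edges_cons, List.mem_cons, ih, oddExp_cons, evenExp_cons]
    by_cases he : e = edgeOf h
    · subst he
      simp [edgeOf]
    · have : (e : Sym2 V) ≠ s(_, _) := fun h' => he (Subtype.ext h')
      simp [this, Ne.symm he, or_comm]

lemma altSum_apply_eq_zero {u v : V} (w : G.Walk u v) (e : G.edgeSet)
    (he : (e : Sym2 V) ∉ w.edges) : altSum w e = 0 := by
  rw [mem_edges_iff] at he
  push Not at he
  simp [← castInt_oddExp_sub, he.1, he.2]

lemma mem_graphIdeal_iff (K : Type*) [Field K] (u v : G.edgeSet →₀ ℕ) :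
    binom K u v ∈ graphIdeal K G ↔ boundary (castInt u - castInt v) = 0 := by
  have hdeg : ∀ x : G.edgeSet →₀ ℕ,
      aDegree (fun e : G.edgeSet => edgeVector (e : Sym2 V)) x = boundary (castInt x) := by
    intro x
    rw [aDegree, boundary, Finsupp.linearCombination_apply, castInt,
      Finsupp.mapRange.addMonoidHom_apply, Finsupp.sum_mapRange_index (by simp)]
    simp
  rw [map_sub, sub_eq_zero]
  constructor
  · intro h
    let D : (G.edgeSet →₀ ℕ) →+ (V →₀ ℤ) := boundary.toAddMonoidHom.comp castInt
    have hle : graphIdeal K G ≤ RingHom.ker (gradeHom K D) := by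
      rw [graphIdeal, toricIdeal, Ideal.span_le]
      rintro p ⟨a, b, hab, rfl⟩
      rw [hdeg, hdeg] at hab
      exact (gradeHom_binom_eq_zero_iff D a b).2 hab
    exact (gradeHom_binom_eq_zero_iff D u v).1 (hle h)
  · intro h
    exact Ideal.subset_span ⟨u, v, by rw [hdeg, hdeg, h], rfl⟩

/-- The lattice of a connected graph is generated by the even closed walks at a vertex. -/
lemma mem_of_boundary_eq_zero {S : Set V} {r : V} (H : AddSubgroup (G.edgeSet →₀ ℤ))
    (hH : ∀ η ∈ H, boundary η = 0)
    (hp : ∀ x ∈ S, ∃ p : G.Walk r x, ∀ y ∈ p.support, y ∈ S)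
    (hc : ∀ c : G.Walk r r, Even c.length → (∀ y ∈ c.support, y ∈ S) → altSum c ∈ H)
    {γ : G.edgeSet →₀ ℤ} (hγ : boundary γ = 0)
    (hS : ∀ e ∈ γ.support, ∀ x ∈ (e : Sym2 V), x ∈ S) : γ ∈ H := by
  classical
  choose p hpS using hp
  -- `ω` is the alternating sum of one odd closed walk at `r`, or zero if there is none. Any other
  -- odd one differs from `-ω` by an even closed walk.
  obtain ⟨ω, hω, hω'⟩ : ∃ ω : G.edgeSet →₀ ℤ,
      (ω = 0 ∨ boundary ω = (2 : ℤ) • Finsupp.single r (1 : ℤ)) ∧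
      ∀ c : G.Walk r r, (∀ y ∈ c.support, y ∈ S) →
        altSum c ∈ H ⊔ AddSubgroup.zmultiples ω := by
    by_cases ho : ∃ o : G.Walk r r, Odd o.length ∧ ∀ y ∈ o.support, y ∈ S
    · obtain ⟨o, ho, hoS⟩ := ho
      refine ⟨altSum o, Or.inr ?_, fun c hcS => ?_⟩
      · rw [boundary_altSum, ho.neg_one_pow]
        module
      · rcases Nat.even_or_odd c.length with h | h
        · exact AddSubgroup.mem_sup_left (hc c h hcS)
        · have h1 : altSum (c.append o) ∈ H := by
            refine hc _ ?_ ?_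
            · rw [Walk.length_append]; exact h.add_odd ho
            · intro y hy
              rcases (Walk.mem_support_append_iff _ _).1 hy with hy | hy
              exacts [hcS y hy, hoS y hy]
          rw [altSum_append, h.neg_one_pow] at h1
          have h2 : altSum c = (altSum c + (-1 : ℤ) • altSum o) + altSum o := by module
          rw [h2]
          exact add_mem (AddSubgroup.mem_sup_left h1)
            (AddSubgroup.mem_sup_right (AddSubgroup.mem_zmultiples _))
    · push Not at ho
      refine ⟨0, Or.inl rfl, fun c hcS => AddSubgroup.mem_sup_left (hc c ?_ hcS)⟩
      by_contra h
      obtain ⟨y, hy, hy'⟩ := ho c (Nat.not_even_iff_odd.1 h)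
      exact hy' (hcS y hy)
  -- The signs are chosen so that an edge plus the `ψ` of its two ends is, up to sign, the
  -- alternating sum of a closed walk through `r`. Summed over `γ`, the added terms give `Ψ
  -- (boundary γ) = 0`.
  let ψ : V → (G.edgeSet →₀ ℤ) := fun x =>
    if h : x ∈ S then (-1 : ℤ) ^ (p x h).length • altSum (p x h) else 0
  let Ψ : (V →₀ ℤ) →ₗ[ℤ] (G.edgeSet →₀ ℤ) := Finsupp.linearCombination ℤ ψ
  have hsum : γ = ∑ e ∈ γ.support,
      γ e • (Finsupp.single e (1 : ℤ) + Ψ (edgeVector (e : Sym2 V))) := by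
    have h1 : Ψ (boundary γ) = ∑ e ∈ γ.support, γ e • Ψ (edgeVector (e : Sym2 V)) := by
      have h2 : boundary γ = ∑ e ∈ γ.support, γ e • edgeVector (e : Sym2 V) :=
        Finsupp.linearCombination_apply _ _
      rw [h2, map_sum]
      simp
    simp only [smul_add, Finset.sum_add_distrib]
    rw [← h1, hγ, map_zero, add_zero]
    conv_lhs => rw [← Finsupp.sum_single γ]
    simp [Finsupp.sum]
  have hη : ∀ e ∈ γ.support, Finsupp.single e (1 : ℤ) + Ψ (edgeVector (e : Sym2 V)) ∈
      H ⊔ AddSubgroup.zmultiples ω := by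
    rintro ⟨e, he⟩ hmem
    have heS := hS _ hmem
    induction e with
    | h x y =>
      have hx : x ∈ S := heS x (by simp)
      have hy : y ∈ S := heS y (by simp)
      have hxy : G.Adj x y := he
      let c : G.Walk r r := (p x hx).append (.cons hxy (p y hy).reverse)
      have hcS : ∀ z ∈ c.support, z ∈ S := by
        intro z hz
        rcases (Walk.mem_support_append_iff _ _).1 hz with hz | hz
        · exact hpS x hx z hz
        · rw [Walk.support_cons, List.mem_cons, Walk.support_reverse, List.mem_reverse] at hz
          rcases hz with rfl | hz
          exacts [hx, hpS y hy z hz]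
      have h1 : Ψ (edgeVector s(x, y)) =
          (-1 : ℤ) ^ (p x hx).length • altSum (p x hx) +
            (-1 : ℤ) ^ (p y hy).length • altSum (p y hy) := by
        have : edgeVector s(x, y) = Finsupp.single x (1 : ℤ) + Finsupp.single y 1 := rfl
        simp [this, Ψ, ψ, hx, hy]
      have h2 : Finsupp.single (⟨s(x, y), he⟩ : G.edgeSet) (1 : ℤ) + Ψ (edgeVector s(x, y)) =
          (-1 : ℤ) ^ (p x hx).length • altSum c := by
        rw [h1]
        simp only [c, altSum_append, altSum_cons, altSum_reverse, smul_add, smul_sub, smul_smul,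
          ← mul_assoc, ← mul_pow, pow_succ]
        simp only [edgeOf]
        norm_num
        abel
      rw [h2]
      exact zsmul_mem (hω' c hcS) _
  have hmem : γ ∈ H ⊔ AddSubgroup.zmultiples ω := by
    rw [hsum]
    exact sum_mem fun e he => zsmul_mem (hη e he) _
  obtain ⟨η, hηH, z, hz, hηz⟩ := AddSubgroup.mem_sup.1 hmem
  obtain ⟨k, rfl⟩ := AddSubgroup.mem_zmultiples_iff.1 hz
  rcases hω with rfl | hω
  · rw [smul_zero, add_zero] at hηz
    exact hηz ▸ hηH
  -- The boundary of `k • ω` is `2k` times the vertex `r`, so `k = 0`.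
  · have h1 := congrArg boundary hηz
    rw [map_add, hH η hηH, hγ, zero_add, map_smul, hω] at h1
    have h2 := DFunLike.congr_fun h1 r
    have h3 : k = 0 := by simpa using h2
    rw [h3, zero_smul, add_zero] at hηz
    exact hηz ▸ hηH

lemma exists_append_cons {u v : V} (w : G.Walk u v) (e : G.edgeSet) :
    (oddExp w e ≠ 0 → ∃ (x y : V) (p : G.Walk u x) (h : G.Adj x y) (q : G.Walk y v),
      w = p.append (.cons h q) ∧ edgeOf h = e ∧ Even p.length) ∧
    (evenExp w e ≠ 0 → ∃ (x y : V) (p : G.Walk u x) (h : G.Adj x y) (q : G.Walk y v),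
      w = p.append (.cons h q) ∧ edgeOf h = e ∧ Odd p.length) := by
  classical
  induction w with
  | nil => simp
  | cons h w ih =>
    constructor
    · intro he
      by_cases hh : edgeOf h = e
      · exact ⟨_, _, .nil, h, w, rfl, hh, by simp⟩
      · obtain ⟨x, y, p, h', q, rfl, h1, h2⟩ := ih.2 (by
          simpa [Finsupp.single_apply, hh] using he)
        exact ⟨x, y, .cons h p, h', q, rfl, h1, by simpa using h2.add_one⟩
    · intro he
      obtain ⟨x, y, p, h', q, rfl, h1, h2⟩ := ih.1 he
      exact ⟨x, y, .cons h p, h', q, rfl, h1, by simpa using h2.add_one⟩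

lemma exists_append_cons_append_cons {u v : V} (w : G.Walk u v) (e : G.edgeSet)
    (ho : oddExp w e ≠ 0) (he : evenExp w e ≠ 0) :
    ∃ (x y x' y' : V) (p : G.Walk u x) (h : G.Adj x y) (q : G.Walk y x') (h' : G.Adj x' y')
      (t : G.Walk y' v), w = p.append (.cons h (q.append (.cons h' t))) ∧
        edgeOf h = e ∧ edgeOf h' = e ∧ Even q.length := by
  classical
  induction w with
  | nil => simp at ho
  | cons h w ih =>
    by_cases hh : edgeOf h = e
    · obtain ⟨x, y, q, h', t, rfl, h1, h2⟩ := (exists_append_cons w e).1 he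
      exact ⟨_, _, x, y, .nil, h, q, h', t, rfl, hh, h1, h2⟩
    · obtain ⟨x, y, x', y', p, h1, q, h2, t, rfl, h3⟩ :=
        ih he (by simpa [Finsupp.single_apply, hh] using ho)
      exact ⟨x, y, x', y', .cons h p, h1, q, h2, t, rfl, h3⟩

/-- Among the even closed walks with nonzero alternating sum, there is one in which no edge occurs
both in an odd and in an even position. -/
lemma exists_disjoint_walk {S : Set V} (n : ℕ) : ∀ {v : V} (w : G.Walk v v), w.length ≤ n →
    Even w.length → (∀ y ∈ w.support, y ∈ S) → altSum w ≠ 0 →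
    ∃ (x : V) (w' : G.Walk x x), Even w'.length ∧ (∀ y ∈ w'.support, y ∈ S) ∧ altSum w' ≠ 0 ∧
      Disjoint (oddExp w').support (evenExp w').support := by
  induction n with
  | zero =>
    intro v w hn _ _ h0
    cases w with
    | nil => exact absurd rfl h0
    | cons h p => simp at hn
  | succ n ih =>
    intro v w hn hw hS h0
    by_cases hd : Disjoint (oddExp w).support (evenExp w).support
    · exact ⟨v, w, hw, hS, h0, hd⟩
    · obtain ⟨e, h1, h2⟩ := Finset.not_disjoint_iff.1 hd
      obtain ⟨x, y, x', y', p, h, q, h', t, rfl, rfl, hee, hq⟩ :=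
        exists_append_cons_append_cons w e (Finsupp.mem_support_iff.1 h1)
          (Finsupp.mem_support_iff.1 h2)
      simp only [Walk.length_append, Walk.length_cons] at hn hw
      simp only [Walk.mem_support_append_iff, Walk.support_cons, List.mem_cons] at hS
      have heq : s(x', y') = s(x, y) := congrArg Subtype.val hee
      simp only [altSum_append, altSum_cons, hee, hq.neg_one_pow] at h0
      rcases Sym2.eq_iff.1 heq with ⟨rfl, rfl⟩ | ⟨rfl, rfl⟩
      -- The edge is run twice in the same direction: dropping both copies and reversing `q` keeps
      -- the alternating sum, as `q` is even.
      · refine ih (p.append (q.reverse.append t)) ?_ ?_ ?_ ?_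
        · simp only [Walk.length_append, Walk.length_reverse]; omega
        · simp only [Walk.length_append, Walk.length_reverse]; grind
        · intro z hz
          simp only [Walk.mem_support_append_iff, Walk.support_reverse, List.mem_reverse] at hz
          exact hS z (by tauto)
        · intro h3
          apply h0
          rw [← h3]
          simp only [altSum_append, altSum_reverse, Walk.length_reverse, hq.neg_one_pow,
            hq.add_one.neg_one_pow]
          module
      -- The edge is run in opposite directions, so `q` and `p.append t` are both closed, and one of
      -- them has nonzero alternating sum.
      · by_cases hqz : altSum q = 0
        · refine ih (p.append t) ?_ ?_ ?_ ?_
          · simp only [Walk.length_append]; omega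
          · simp only [Walk.length_append]; grind
          · intro z hz
            simp only [Walk.mem_support_append_iff] at hz
            exact hS z (by tauto)
          · intro h3
            apply h0
            rw [← h3, altSum_append, hqz]
            module
        · exact ih q (by omega) hq (fun z hz => hS z (by tauto)) hqz

end Walks

/-! ### Fundamental walks are circuits with few chords -/

section Fundamental

variable {V : Type*} {G : SimpleGraph V}

/-- The linear form on edge vectors given by `A` takes the value `c` on the edges in odd positions
of the walk, and `-c` on those in even positions. -/
def HasSigns (A : G.edgeSet → ℤ) (c : ℤ) {u v : V} (p : G.Walk u v) : Prop :=
  ∀ e, (oddExp p e ≠ 0 → A e = c) ∧ (evenExp p e ≠ 0 → A e = -c)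

lemma hasSigns_cons {A : G.edgeSet → ℤ} {c : ℤ} {u v x : V} {h : G.Adj u v} {p : G.Walk v x}
    (hs : HasSigns A c (.cons h p)) : A (edgeOf h) = c ∧ HasSigns A (-c) p := by
  refine ⟨(hs _).1 (by simp), fun e => ⟨fun he => (hs e).2 he, fun he => ?_⟩⟩
  rw [neg_neg]
  exact (hs e).1 (by simp only [oddExp_cons, Finsupp.add_apply]; omega)

lemma HasSigns.of_append_left {A : G.edgeSet → ℤ} {u v x : V} {p : G.Walk u v} :
    ∀ {c : ℤ} {q : G.Walk v x}, HasSigns A c (p.append q) → HasSigns A c p := by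
  classical
  induction p with
  | nil => intro c q _ e; simp
  | cons h p ih =>
    intro c q hs
    obtain ⟨h1, h2⟩ := hasSigns_cons hs
    intro e
    have h3 := ih h2 e
    rw [neg_neg] at h3
    refine ⟨fun he => ?_, fun he => h3.1 he⟩
    by_cases hh : edgeOf h = e
    · rw [← hh, h1]
    · exact h3.2 (by simpa [Finsupp.single_apply, hh] using he)

lemma HasSigns.of_append_right {A : G.edgeSet → ℤ} {u v x : V} {p : G.Walk u v} :
    ∀ {c : ℤ} {q : G.Walk v x}, HasSigns A c (p.append q) → HasSigns A ((-1) ^ p.length * c) q := by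
  induction p with
  | nil => intro c q hs; simpa using hs
  | cons h p ih =>
    intro c q hs
    have := ih (hasSigns_cons hs).2
    rwa [Walk.length_cons, pow_succ, mul_assoc, neg_one_mul]

/-- The sign in the alternating sum cancels that of `A`, so each step contributes `c`: the form
measures length. -/
lemma HasSigns.linearCombination_altSum {A : G.edgeSet → ℤ} {u v : V} {p : G.Walk u v} :
    ∀ {c : ℤ}, HasSigns A c p → Finsupp.linearCombination ℤ A (altSum p) = c * p.length := by
  induction p with
  | nil => simp
  | cons h p ih =>
    intro c hs
    obtain ⟨h1, h2⟩ := hasSigns_cons hs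
    rw [altSum_cons, map_sub, ih h2, Finsupp.linearCombination_single, h1]
    simp
    ring

lemma exists_hasSigns {u v : V} {w : G.Walk u v}
    (hd : Disjoint (oddExp w).support (evenExp w).support) :
    ∃ A : G.edgeSet → ℤ, HasSigns A 1 w := by
  classical
  refine ⟨fun e => if oddExp w e ≠ 0 then 1 else -1, fun e => ⟨fun he => if_pos he, fun he => ?_⟩⟩
  refine if_neg fun he' => Finset.disjoint_left.1 hd (Finsupp.mem_support_iff.2 he')
    (Finsupp.mem_support_iff.2 he)

/-- A walk whose alternating sum has no cancellation is not the multiple of that of a shorter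
closed walk inside it. -/
lemma length_eq_of_append_altSum {v x : V} {p : G.Walk v x} {c : G.Walk x x} {q : G.Walk x v}
    (hd : Disjoint (oddExp (p.append (c.append q))).support
      (evenExp (p.append (c.append q))).support)
    (hc : ¬ c.Nil)
    (h : altSum c ∈ AddSubgroup.zmultiples (altSum (p.append (c.append q)))) :
    c.length = (p.append (c.append q)).length := by
  obtain ⟨A, hA⟩ := exists_hasSigns hd
  obtain ⟨k, hk⟩ := AddSubgroup.mem_zmultiples_iff.1 h
  have h1 := congrArg (Finsupp.linearCombination ℤ A) hk
  rw [map_smul, hA.linearCombination_altSum,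
    hA.of_append_right.of_append_left.linearCombination_altSum] at h1
  have hpos : 0 < c.length := Walk.not_nil_iff_lt_length.1 hc
  have hle : c.length ≤ (p.append (c.append q)).length := by
    simp only [Walk.length_append]; omega
  refine le_antisymm hle ?_
  have hdvd : ((p.append (c.append q)).length : ℤ) ∣ (c.length : ℤ) := by
    rcases neg_one_pow_eq_or ℤ p.length with h2 | h2 <;> rw [h2] at h1
    · exact ⟨k, by rw [smul_eq_mul] at h1; linarith⟩
    · exact ⟨-k, by rw [smul_eq_mul] at h1; linarith⟩
  exact Nat.le_of_dvd hpos (Int.natCast_dvd_natCast.1 hdvd)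

/-- The alternating sum of every even closed walk on the vertices of `w` is a multiple of that
of `w`. -/
def Generates {v : V} (w : G.Walk v v) : Prop :=
  ∀ (x : V) (c : G.Walk x x), Even c.length → (∀ y ∈ c.support, y ∈ w.support) →
    altSum c ∈ AddSubgroup.zmultiples (altSum w)

variable {v : V} {w : G.Walk v v}

lemma IsFundamentalWalk.generates {K : Type*} [Field K] (h : IsFundamentalWalk K w) :
    Generates w := by
  intro x c hc hS
  have := h x c hc hS
  rw [walkBinomial_eq, walkBinomial_eq] at this
  simpa only [castInt_oddExp_sub] using sub_mem_zmultiples_of_binom_mem this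

/-- A variable common to both monomials would divide every binomial of the ideal, including one with
coprime monomials supplied by `exists_disjoint_walk`. -/
lemma IsFundamentalWalk.disjoint {K : Type*} [Field K] (h : IsFundamentalWalk K w)
    (hw : Even w.length) (h0 : altSum w ≠ 0) :
    Disjoint (oddExp w).support (evenExp w).support := by
  classical
  obtain ⟨x, c, hc, hS, hc0, hd⟩ :=
    exists_disjoint_walk (S := {y | y ∈ w.support}) w.length w le_rfl hw (fun _ hy => hy) h0
  rw [Finset.disjoint_left]
  intro e h1 h2
  rw [Finsupp.mem_support_iff] at h1 h2
  have hmem := h x c hc hS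
  have hdvd : MvPolynomial.monomial (Finsupp.single e 1) (1 : K) ∣ walkBinomial K w := by
    rw [walkBinomial_eq, ← single_add_tsub_single h1, ← single_add_tsub_single h2, binom_add_left]
    exact dvd_mul_right _ _
  obtain ⟨q, hq⟩ := hdvd.trans (Ideal.mem_span_singleton.1 hmem)
  rw [walkBinomial_eq, binom] at hq
  have hne := (oddExp_ne_evenExp_iff c).2 hc0
  have hcoeff : ∀ a : G.edgeSet →₀ ℕ, a e = 0 →
      MvPolynomial.coeff a (MvPolynomial.monomial (Finsupp.single e 1) (1 : K) * q) = 0 := by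
    intro a ha
    rw [MvPolynomial.coeff_monomial_mul', if_neg]
    intro hle
    rw [Finsupp.single_le_iff] at hle
    omega
  have hz : oddExp c e = 0 ∨ evenExp c e = 0 := eq_zero_or_eq_zero_of_disjoint hd e
  rcases hz with hz | hz
  · have := hcoeff _ hz
    rw [← hq] at this
    simp [MvPolynomial.coeff_monomial, hne.symm] at this
  · have := hcoeff _ hz
    rw [← hq] at this
    simp [MvPolynomial.coeff_monomial, hne] at this

lemma exists_walk_of_mem_support (w : G.Walk v v) {x : V} (hx : x ∈ w.support) :
    ∃ p : G.Walk v x, (∀ y ∈ p.support, y ∈ w.support) ∧ ∀ e ∈ p.edges, e ∈ w.edges := by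
  classical
  exact ⟨w.takeUntil x hx, fun _ h => w.support_takeUntil_subset_support hx h,
    fun _ h => w.edges_takeUntil_subset_edges hx h⟩

lemma boundary_eq_zero_of_mem_zmultiples (hw : Even w.length) {η : G.edgeSet →₀ ℤ}
    (h : η ∈ AddSubgroup.zmultiples (altSum w)) : boundary η = 0 := by
  obtain ⟨k, rfl⟩ := AddSubgroup.mem_zmultiples_iff.1 h
  rw [map_smul, boundary_altSum_of_even w hw, smul_zero]

lemma Generates.mem_zmultiples (h : Generates w) (hw : Even w.length) {γ : G.edgeSet →₀ ℤ}
    (hγ : boundary γ = 0) (hS : ∀ e ∈ γ.support, ∀ x ∈ (e : Sym2 V), x ∈ w.support) :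
    γ ∈ AddSubgroup.zmultiples (altSum w) :=
  mem_of_boundary_eq_zero (S := {y | y ∈ w.support}) _
    (fun _ hη => boundary_eq_zero_of_mem_zmultiples hw hη)
    (fun _ hx => (exists_walk_of_mem_support w hx).imp fun _ hp => hp.1)
    (fun c hc hcS => h v c hc hcS) hγ hS

lemma Generates.prime_walkBinomial (K : Type*) [Field K] (h : Generates w) (hw : Even w.length)
    (h0 : altSum w ≠ 0) (hd : Disjoint (oddExp w).support (evenExp w).support) :
    Prime (walkBinomial K w) := by
  classical
  -- `Generates` only controls vectors on `G_w`, so the grading also records the exponents of the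
  -- edges outside it.
  let P : G.edgeSet → Prop := fun e => ¬ ∀ x ∈ (e : Sym2 V), x ∈ w.support
  let D : (G.edgeSet →₀ ℕ) →+ (V →₀ ℤ) × (G.edgeSet →₀ ℤ) :=
    (boundary.toAddMonoidHom.comp castInt).prod (castInt.comp (Finsupp.filterAddHom P))
  have hD : ∀ a b, D a = D b ↔ boundary (castInt a - castInt b) = 0 ∧ ∀ e, P e → a e = b e := by
    intro a b
    have h1 : D a = D b ↔ boundary (castInt a) = boundary (castInt b) ∧
        castInt (a.filter P) = castInt (b.filter P) := Prod.ext_iff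
    rw [h1, castInt_injective.eq_iff, map_sub, sub_eq_zero]
    refine and_congr_right fun _ => ⟨fun hab e he => ?_, fun hab => ?_⟩
    · simpa [Finsupp.filter_apply_pos P _ he] using DFunLike.congr_fun hab e
    · ext e
      by_cases he : P e
      · rw [Finsupp.filter_apply_pos P _ he, Finsupp.filter_apply_pos P _ he, hab e he]
      · rw [Finsupp.filter_apply_neg P _ he, Finsupp.filter_apply_neg P _ he]
  rw [walkBinomial_eq]
  refine prime_binom D ((oddExp_ne_evenExp_iff w).2 h0) ?_ ?_
  · rw [hD, castInt_oddExp_sub]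
    refine ⟨boundary_altSum_of_even w hw, fun e he => ?_⟩
    have h1 : (e : Sym2 V) ∉ w.edges := fun hmem =>
      he fun x hx => Walk.mem_support_of_mem_edges hmem hx
    rw [mem_edges_iff] at h1
    push Not at h1
    rw [h1.1, h1.2]
  · intro a b hab
    rw [hD] at hab
    refine binom_mem_of_sub_mem_zmultiples hd ?_
    rw [castInt_oddExp_sub]
    refine h.mem_zmultiples hw hab.1 fun e he => ?_
    by_contra hP
    rw [Finsupp.mem_support_iff] at he
    exact he (by simp [hab.2 e hP])

/-- A binomial with smaller support would have a nonzero multiple of `altSum w` as exponent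
difference, and this already involves every edge of `w`. -/
lemma Generates.isCircuit (K : Type*) [Field K] (h : Generates w) (hw : Even w.length)
    (h0 : altSum w ≠ 0) (hd : Disjoint (oddExp w).support (evenExp w).support) :
    IsCircuit (graphIdeal K G) (walkBinomial K w) := by
  classical
  have hne := (oddExp_ne_evenExp_iff w).2 h0
  refine ⟨⟨_, _, hne, walkBinomial_eq K w⟩, ?_, (h.prime_walkBinomial K hw h0 hd).irreducible, ?_⟩
  · rw [walkBinomial_eq, mem_graphIdeal_iff, castInt_oddExp_sub, boundary_altSum_of_even w hw]
  · rintro _ ⟨a, b, hab, rfl⟩ hmem hss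
    rw [← binom, vars_binom hab, walkBinomial_eq, vars_binom hne] at hss
    rw [← binom, mem_graphIdeal_iff] at hmem
    have hsub : ∀ e, castInt a e - castInt b e ≠ 0 → e ∈ a.support ∪ b.support := by
      intro e he
      by_contra hcon
      simp only [Finset.mem_union, Finsupp.mem_support_iff, not_or, not_not] at hcon
      simp [hcon.1, hcon.2] at he
    have hmul : castInt a - castInt b ∈ AddSubgroup.zmultiples (altSum w) := by
      refine h.mem_zmultiples hw hmem fun e he x hx => ?_
      have h1 := hss.1 (hsub e (Finsupp.mem_support_iff.1 he))
      simp only [Finset.mem_union, Finsupp.mem_support_iff] at h1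
      exact Walk.mem_support_of_mem_edges ((mem_edges_iff w e).2 h1) hx
    obtain ⟨k, hk⟩ := AddSubgroup.mem_zmultiples_iff.1 hmul
    have hk0 : k ≠ 0 := by
      rintro rfl
      rw [zero_smul, eq_comm, sub_eq_zero] at hk
      exact hab (castInt_injective hk)
    refine hss.2 fun e he => hsub e ?_
    have h1 := DFunLike.congr_fun hk e
    rw [Finsupp.sub_apply] at h1
    rw [← h1, Finsupp.smul_apply, smul_eq_mul, ← castInt_oddExp_sub]
    refine mul_ne_zero hk0 ?_
    have h2 : oddExp w e = 0 ∨ evenExp w e = 0 := eq_zero_or_eq_zero_of_disjoint hd e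
    simp only [Finset.mem_union, Finsupp.mem_support_iff] at he
    simp only [Finsupp.sub_apply, castInt_apply]
    omega

lemma Generates.altSum_apply_eq_zero (h : Generates w) {x : V} {c : G.Walk x x}
    (hc : Even c.length) (hS : ∀ y ∈ c.support, y ∈ w.support) {f : G.edgeSet}
    (hf : (f : Sym2 V) ∉ w.edges) : altSum c f = 0 := by
  obtain ⟨k, hk⟩ := AddSubgroup.mem_zmultiples_iff.1 (h x c hc hS)
  rw [← hk, Finsupp.smul_apply, ToricGraph.altSum_apply_eq_zero w f hf, smul_zero]

/-- Two walks of `w` from its base vertex to the ends of a chord, together with the chord, form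
an odd closed walk that uses the chord once. -/
lemma Generates.odd_chord_walk (h : Generates w) {x y : V} {hxy : G.Adj x y}
    (hf : s(x, y) ∉ w.edges) {p : G.Walk v x} {q : G.Walk v y}
    (hpS : ∀ z ∈ p.support, z ∈ w.support) (hqS : ∀ z ∈ q.support, z ∈ w.support)
    (hp : ∀ e ∈ p.edges, e ∈ w.edges) (hq : ∀ e ∈ q.edges, e ∈ w.edges) :
    (∀ z ∈ (p.append (.cons hxy q.reverse)).support, z ∈ w.support) ∧
      (∀ e ∈ (p.append (.cons hxy q.reverse)).edges, e = s(x, y) ∨ e ∈ w.edges) ∧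
      altSum (p.append (.cons hxy q.reverse)) (edgeOf hxy) ≠ 0 ∧
      Odd (p.append (.cons hxy q.reverse)).length := by
  have hS : ∀ z ∈ (p.append (.cons hxy q.reverse)).support, z ∈ w.support := by
    intro z hz
    simp only [Walk.mem_support_append_iff, Walk.support_cons, List.mem_cons,
      Walk.support_reverse, List.mem_reverse] at hz
    rcases hz with hz | rfl | hz
    exacts [hpS z hz, hpS z p.end_mem_support, hqS z hz]
  have h0 : altSum (p.append (.cons hxy q.reverse)) (edgeOf hxy) ≠ 0 := by
    have h1 : altSum p (edgeOf hxy) = 0 :=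
      ToricGraph.altSum_apply_eq_zero p _ fun hmem => hf (hp _ hmem)
    have h2 : altSum q (edgeOf hxy) = 0 :=
      ToricGraph.altSum_apply_eq_zero q _ fun hmem => hf (hq _ hmem)
    simp [altSum_append, altSum_reverse, h1, h2]
  refine ⟨hS, fun e he => ?_, h0, ?_⟩
  · simp only [Walk.edges_append, Walk.edges_cons, Walk.edges_reverse, List.mem_append,
      List.mem_cons, List.mem_reverse] at he
    rcases he with he | rfl | he
    exacts [Or.inr (hp e he), Or.inl rfl, Or.inr (hq e he)]
  · rw [← Nat.not_even_iff_odd]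
    exact fun he => h0 (h.altSum_apply_eq_zero he hS hf)

/-- If `w` has a chord, then every closed walk at its base vertex which avoids the chord is
even. -/
lemma Generates.even_of_isChord (h : Generates w) {f : Sym2 V} (hf : IsChord w f)
    (c : G.Walk v v) (hS : ∀ y ∈ c.support, y ∈ w.support) (hfc : f ∉ c.edges) :
    Even c.length := by
  obtain ⟨hfG, hfS, hfw⟩ := hf
  induction f with
  | h x y =>
    have hxy : G.Adj x y := hfG
    obtain ⟨p, hpS, hp⟩ := exists_walk_of_mem_support w (hfS x (by simp))
    obtain ⟨q, hqS, hq⟩ := exists_walk_of_mem_support w (hfS y (by simp))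
    obtain ⟨h1, -, h2, h3⟩ := h.odd_chord_walk (hxy := hxy) hfw hpS hqS hp hq
    set d := p.append (.cons hxy q.reverse)
    by_contra hodd
    rw [Nat.not_even_iff_odd] at hodd
    -- Two odd closed walks compose to an even one that uses the chord exactly once.
    have h4 : altSum (d.append c) (edgeOf hxy) = 0 := by
      refine h.altSum_apply_eq_zero ?_ ?_ hfw
      · rw [Walk.length_append]; exact h3.add_odd hodd
      · intro z hz
        rcases (Walk.mem_support_append_iff _ _).1 hz with hz | hz
        exacts [h1 z hz, hS z hz]
    have h5 : altSum c (edgeOf hxy) = 0 := ToricGraph.altSum_apply_eq_zero c _ hfc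
    rw [altSum_append, Finsupp.add_apply, Finsupp.smul_apply, h5, smul_zero, add_zero] at h4
    exact h2 h4

/-- The odd closed walk through `g` avoids `f`, against `even_of_isChord`. -/
lemma Generates.chord_unique (h : Generates w) {f g : Sym2 V} (hf : IsChord w f)
    (hg : IsChord w g) : f = g := by
  by_contra hne
  obtain ⟨hgG, hgS, hgw⟩ := hg
  induction g with
  | h x y =>
    have hxy : G.Adj x y := hgG
    obtain ⟨p, hpS, hp⟩ := exists_walk_of_mem_support w (hgS x (by simp))
    obtain ⟨q, hqS, hq⟩ := exists_walk_of_mem_support w (hgS y (by simp))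
    obtain ⟨h1, h2, -, h3⟩ := h.odd_chord_walk (hxy := hxy) hgw hpS hqS hp hq
    refine Nat.not_even_iff_odd.2 h3 (h.even_of_isChord hf _ h1 fun hmem => ?_)
    rcases h2 f hmem with h4 | h4
    exacts [hne h4, hf.2.2 h4]

/-- Joining the chord to the base along the first `i` and `j` steps gives length `i + 1 + j`, of the
parity of `j - i + 1`. -/
lemma Generates.not_isEvenChordOfCycle (h : Generates w) (f : Sym2 V) :
    ¬ IsEvenChordOfCycle w f := by
  rintro ⟨-, ⟨hfG, -, hfw⟩, i, j, hij, hj, rfl, he, -⟩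
  have hS : ∀ k, ∀ z ∈ (w.take k).support, z ∈ w.support := fun k z hz =>
    (w.isSubwalk_take k).support_subset hz
  have hE : ∀ k, ∀ e ∈ (w.take k).edges, e ∈ w.edges := fun k e he =>
    (w.isSubwalk_take k).edges_subset he
  have hxy : G.Adj (w.getVert i) (w.getVert j) := hfG
  obtain ⟨-, -, -, h3⟩ := h.odd_chord_walk (hxy := hxy) hfw (hS i) (hS j) (hE i) (hE j)
  simp only [Walk.length_append, Walk.length_cons, Walk.length_reverse, Walk.take_length,
    min_eq_left hj.le, min_eq_left (hij.trans hj).le] at h3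
  grind

lemma Generates.isCycle_of_isChord (h : Generates w) (hw : Even w.length) (h0 : altSum w ≠ 0)
    (hd : Disjoint (oddExp w).support (evenExp w).support) {f : Sym2 V} (hf : IsChord w f) :
    w.IsCycle := by
  rw [Walk.isCycle_iff_isPath_tail_and_le_length]
  constructor
  · cases w with
    | nil => exact absurd rfl h0
    | cons hadj p =>
      suffices hpath : p.IsPath by
        simpa only [Walk.getVert_cons_succ, Walk.tail_cons, Walk.isPath_copy] using hpath
      rw [Walk.isPath_iff_isSubwalk_imp_nil]
      rintro x c ⟨r, t, rfl⟩
      by_contra hnil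
      have heq : Walk.cons hadj ((r.append c).append t) =
          (Walk.cons hadj r).append (c.append t) := by
        rw [Walk.cons_append, Walk.append_assoc]
      rw [heq] at h hw h0 hd hf
      -- Going out along the initial segment, around `c` and back does not change the parity of `c`.
      have hev : Even (((Walk.cons hadj r).append c).append (Walk.cons hadj r).reverse).length := by
        refine h.even_of_isChord hf _ ?_ ?_
        · intro z hz
          simp only [Walk.mem_support_append_iff, Walk.support_reverse, List.mem_reverse] at hz ⊢
          tauto
        · intro hmem
          apply hf.2.2
          simp only [Walk.edges_append, Walk.edges_reverse, List.mem_reverse,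
            List.mem_append] at hmem ⊢
          tauto
      have hce : Even c.length := by
        simp only [Walk.length_append, Walk.length_reverse] at hev
        grind
      have hl := length_eq_of_append_altSum hd hnil (h x c hce fun z hz => by
        simp only [Walk.mem_support_append_iff]
        tauto)
      simp only [Walk.length_append, Walk.length_cons] at hl
      omega
  · by_contra hlt
    match w, h0, hw, hlt with
    | .nil, h0, _, _ => exact h0 rfl
    | .cons _ .nil, _, hw, _ => simp at hw
    -- A closed walk of length two repeats one edge, which cancels.
    | .cons h1 (.cons h2 .nil), h0, _, _ =>
      apply h0
      have : edgeOf h2 = edgeOf h1 := edgeOf_symm h1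
      simp [this]
    | .cons _ (.cons _ (.cons _ p)), _, _, hlt =>
      simp only [Walk.length_cons] at hlt
      omega

end Fundamental

/-! ### Circuits without bad chords are fundamental -/

section Circuit

variable {V : Type*} {G : SimpleGraph V} {K : Type*} [Field K] {v : V} {w : G.Walk v v}

/-- A common variable factors out, and the cofactor is no unit because it vanishes at the all-ones
point. -/
lemma IsCircuit.disjoint (h : IsCircuit (graphIdeal K G) (walkBinomial K w)) :
    Disjoint (oddExp w).support (evenExp w).support := by
  classical
  rw [Finset.disjoint_left]
  intro e h1 h2
  rw [Finsupp.mem_support_iff] at h1 h2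
  have hirr := h.2.2.1
  rw [walkBinomial_eq, ← single_add_tsub_single h1, ← single_add_tsub_single h2, binom_add_left] at hirr
  rcases hirr.isUnit_or_isUnit rfl with hu | hu
  · have := hu.map (MvPolynomial.eval (fun _ : G.edgeSet => (0 : K)))
    simp [MvPolynomial.constantCoeff_monomial] at this
  · exact not_isUnit_binom _ _ hu

lemma IsCircuit.altSum_ne_zero (h : IsCircuit (graphIdeal K G) (walkBinomial K w)) :
    altSum w ≠ 0 := by
  rw [← oddExp_ne_evenExp_iff, ← binom_ne_zero_iff (K := K), ← walkBinomial_eq]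
  exact h.2.2.1.ne_zero

lemma altSum_apply_ne_zero_iff {u v : V} {w : G.Walk u v}
    (hd : Disjoint (oddExp w).support (evenExp w).support) (e : G.edgeSet) :
    altSum w e ≠ 0 ↔ (e : Sym2 V) ∈ w.edges := by
  have h2 : oddExp w e = 0 ∨ evenExp w e = 0 := eq_zero_or_eq_zero_of_disjoint hd e
  rw [mem_edges_iff, ← castInt_oddExp_sub]
  simp only [Finsupp.sub_apply, castInt_apply]
  omega

lemma vars_binom_posVec [DecidableEq G.edgeSet] {γ : G.edgeSet →₀ ℤ} (h : γ ≠ 0) :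
    (binom K (posVec γ) (posVec (-γ))).vars = γ.support := by
  have hne : posVec γ ≠ posVec (-γ) := fun heq => h (by
    rw [← castInt_posVec_sub γ, ← heq, sub_self])
  rw [vars_binom hne]
  ext e
  simp
  omega

lemma vars_walkBinomial [DecidableEq G.edgeSet] (h0 : altSum w ≠ 0)
    (hd : Disjoint (oddExp w).support (evenExp w).support) :
    (walkBinomial K w).vars = (altSum w).support := by
  rw [walkBinomial_eq, vars_binom ((oddExp_ne_evenExp_iff w).2 h0)]
  ext e
  rw [Finsupp.mem_support_iff, altSum_apply_ne_zero_iff hd, mem_edges_iff]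
  simp

/-- Two integer vectors that are proportional are multiples of one vector. -/
lemma exists_smul_eq_of_smul_eq {M : Type*} [AddCommGroup M] [IsAddTorsionFree M] {α β : M}
    {c d : ℤ} (hc : c ≠ 0) (h : c • β = d • α) :
    ∃ (γ : M) (m n s t : ℤ), α = m • γ ∧ β = n • γ ∧ γ = s • α + t • β := by
  obtain ⟨m, n, hg, hm, hn⟩ : ∃ m n : ℤ, IsCoprime m n ∧
      c = m * (Int.gcd c d : ℤ) ∧ d = n * (Int.gcd c d : ℤ) := by
    have hpos : 0 < Int.gcd c d := Int.gcd_pos_of_ne_zero_left d hc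
    obtain ⟨m, n, h1, h2, h3⟩ := Int.exists_gcd_one hpos
    exact ⟨m, n, Int.isCoprime_iff_gcd_eq_one.2 h1, h2, h3⟩
  have hg0 : (Int.gcd c d : ℤ) ≠ 0 := by
    rintro h0
    rw [h0, mul_zero] at hm
    exact hc hm
  have hmn : m • β = n • α := by
    apply zsmul_right_injective hg0
    show (Int.gcd c d : ℤ) • m • β = (Int.gcd c d : ℤ) • n • α
    rw [smul_smul, smul_smul, mul_comm _ m, mul_comm _ n, ← hm, ← hn, h]
  obtain ⟨s, t, hst⟩ := hg
  refine ⟨s • α + t • β, m, n, s, t, ?_, ?_, rfl⟩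
  · calc α = (s * m + t * n) • α := by rw [hst, one_smul]
      _ = (m * s) • α + t • (n • α) := by module
      _ = m • (s • α + t • β) := by rw [← hmn]; module
  · calc β = (s * m + t * n) • β := by rw [hst, one_smul]
      _ = s • (m • β) + (n * t) • β := by module
      _ = n • (s • α + t • β) := by rw [hmn]; module

/-- The vectors of degree zero on the edges of a circuit are multiples of its alternating sum. -/
lemma IsCircuit.mem_zmultiples (h : IsCircuit (graphIdeal K G) (walkBinomial K w))
    (hw : Even w.length) {β : G.edgeSet →₀ ℤ} (hβ : boundary β = 0)
    (hsupp : ∀ e : G.edgeSet, (e : Sym2 V) ∉ w.edges → β e = 0) :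
    β ∈ AddSubgroup.zmultiples (altSum w) := by
  classical
  have hd := h.disjoint
  have h0 := h.altSum_ne_zero
  have hα : boundary (altSum w) = 0 := boundary_altSum_of_even w hw
  obtain ⟨e, he⟩ := Finsupp.ne_iff.1 h0
  rw [Finsupp.zero_apply] at he
  -- The difference vanishes at `e`, so a nonzero one would give a binomial with strictly smaller
  -- support.
  have hprop : altSum w e • β = β e • altSum w := by
    by_contra hne
    rw [← ne_eq, ← sub_ne_zero] at hne
    set δ := altSum w e • β - β e • altSum w with hδ
    have hδe : δ e = 0 := by
      simp [hδ, mul_comm]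
    refine h.2.2.2 (binom K (posVec δ) (posVec (-δ))) ⟨_, _, ?_, rfl⟩ ?_ ?_
    · intro heq
      exact hne (by rw [← castInt_posVec_sub δ, ← heq, sub_self])
    · rw [mem_graphIdeal_iff, castInt_posVec_sub, hδ, map_sub, map_smul, map_smul, hα, hβ]
      simp
    · rw [vars_binom_posVec hne, vars_walkBinomial h0 hd]
      refine Finset.ssubset_iff_subset_ne.2 ⟨fun e' he' => ?_, fun heq => ?_⟩
      · rw [Finsupp.mem_support_iff] at he' ⊢
        intro hz
        apply he'
        have : β e' = 0 := by
          apply hsupp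
          rw [← altSum_apply_ne_zero_iff hd]
          exact not_not.2 hz
        simp [hδ, hz, this]
      · have : e ∈ δ.support := heq ▸ Finsupp.mem_support_iff.2 he
        exact Finsupp.mem_support_iff.1 this hδe
  -- The binomial of `γ` divides the irreducible `B_w`, so the two are associated and `γ` is itself
  -- a multiple of `altSum w`.
  obtain ⟨γ, m, n, s, t, hm, hn, hγ⟩ := exists_smul_eq_of_smul_eq he hprop
  have hmem : walkBinomial K w ∈ Ideal.span {binom K (posVec γ) (posVec (-γ))} := by
    rw [walkBinomial_eq]
    refine binom_mem_of_sub_mem_zmultiples (posVec_disjoint γ) ?_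
    rw [castInt_oddExp_sub, castInt_posVec_sub, hm]
    exact AddSubgroup.zsmul_mem_zmultiples γ m
  have hmem' : binom K (posVec γ) (posVec (-γ)) ∈ Ideal.span {walkBinomial K w} := by
    rw [Ideal.mem_span_singleton] at hmem ⊢
    exact ((h.2.2.1.dvd_iff.1 hmem).resolve_left (not_isUnit_binom _ _)).dvd
  rw [walkBinomial_eq] at hmem'
  have h1 := sub_mem_zmultiples_of_binom_mem hmem'
  rw [castInt_oddExp_sub, castInt_posVec_sub] at h1
  rw [hn]
  exact zsmul_mem h1 n

lemma IsCircuit.isFundamentalBinomial (h : IsCircuit (graphIdeal K G) (walkBinomial K w))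
    (hw : Even w.length)
    (hchord : ∀ β : G.edgeSet →₀ ℤ, boundary β = 0 →
      (∀ e : G.edgeSet, β e ≠ 0 → ∀ x ∈ (e : Sym2 V), x ∈ w.support) →
      ∀ e : G.edgeSet, IsChord w e → β e = 0) :
    IsFundamentalBinomial K w := by
  refine ⟨h.2.2.1.ne_zero, fun x c hc hS => ?_⟩
  rw [walkBinomial_eq, walkBinomial_eq]
  refine binom_mem_of_sub_mem_zmultiples h.disjoint ?_
  rw [castInt_oddExp_sub, castInt_oddExp_sub]
  have hb := boundary_altSum_of_even c hc
  have hSc : ∀ e : G.edgeSet, altSum c e ≠ 0 → ∀ x ∈ (e : Sym2 V), x ∈ w.support := by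
    intro e he x hx
    refine hS x (Walk.mem_support_of_mem_edges ?_ hx)
    by_contra hcon
    exact he (altSum_apply_eq_zero c e hcon)
  refine h.mem_zmultiples hw hb fun e he => ?_
  by_contra hne
  exact hne (hchord _ hb hSc e ⟨e.2, hSc e hne, he⟩)

/-- A chord of an even cycle is even or odd. -/
lemma IsChord.even_or_odd (hcyc : w.IsCycle) (hw : Even w.length) {f : Sym2 V}
    (hf : IsChord w f) : IsEvenChordOfCycle w f ∨ IsOddChordOfCycle w f := by
  have hidx : ∀ x ∈ w.support, ∃ i < w.length, w.getVert i = x := by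
    intro x hx
    obtain ⟨i, hi, hle⟩ := Walk.mem_support_iff_exists_getVert.1 hx
    rcases hle.lt_or_eq with hlt | rfl
    · exact ⟨i, hlt, hi⟩
    -- The last index repeats the base vertex, so it is replaced by `0`.
    · refine ⟨0, by have := hcyc.three_le_length; omega, ?_⟩
      rw [← hi, Walk.getVert_zero, Walk.getVert_length]
  have key : ∀ i j, i < j → j < w.length → IsChord w s(w.getVert i, w.getVert j) →
      IsEvenChordOfCycle w s(w.getVert i, w.getVert j) ∨
        IsOddChordOfCycle w s(w.getVert i, w.getVert j) := by
    intro i j hij hj hc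
    rcases Nat.even_or_odd (j - i + 1) with he | ho
    · exact Or.inl ⟨hcyc, hc, i, j, hij, hj, rfl, he, by grind⟩
    · exact Or.inr ⟨hcyc, hc, i, j, hij, hj, rfl, ho, by grind⟩
  induction f with
  | h x y =>
    obtain ⟨i, hi, rfl⟩ := hidx x (hf.2.1 x (by simp))
    obtain ⟨j, hj, rfl⟩ := hidx y (hf.2.1 y (by simp))
    have hne : i ≠ j := by
      rintro rfl
      exact G.loopless.irrefl _ hf.1
    rcases hne.lt_or_gt with hlt | hlt
    · exact key i j hlt hj hf
    · rw [Sym2.eq_swap] at hf ⊢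
      exact key j i hlt hi hf

/-- The vertices of an even cycle can be given alternating signs. -/
lemma exists_alternating_signs (hcyc : w.IsCycle) (hw : Even w.length) :
    ∃ σ : V → ℤ, ∀ k ≤ w.length, σ (w.getVert k) = (-1) ^ k := by
  classical
  have hlt : ∀ k < w.length, (∃ i < w.length, Even i ∧ w.getVert i = w.getVert k) ↔ Even k := by
    intro k hk
    refine ⟨?_, fun h => ⟨k, hk, h, rfl⟩⟩
    rintro ⟨i, hi, hie, heq⟩
    have := hcyc.getVert_injOn' (by simp; omega) (by simp; omega) heq
    exact this ▸ hie
  refine ⟨fun x => if ∃ i < w.length, Even i ∧ w.getVert i = x then 1 else -1, fun k hk => ?_⟩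
  have main : ∀ k < w.length,
      (if ∃ i < w.length, Even i ∧ w.getVert i = w.getVert k then (1 : ℤ) else -1) =
        (-1) ^ k := by
    intro k hk
    rcases Nat.even_or_odd k with h | h
    · rw [if_pos ((hlt k hk).2 h), h.neg_one_pow]
    · rw [if_neg (fun h' => Nat.not_even_iff_odd.2 h ((hlt k hk).1 h')), h.neg_one_pow]
  rcases hk.lt_or_eq with hk | rfl
  · exact main k hk
  · have := main 0 (by have := hcyc.three_le_length; omega)
    rw [Walk.getVert_zero] at this
    rw [Walk.getVert_length, hw.neg_one_pow]
    simpa using this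

/-- Under alternating signs the ends of a cycle edge cancel, while those of an odd chord have equal
signs and add up to `±2`. Pairing with `boundary β = 0` leaves only the term of `f`. -/
lemma eq_zero_of_unique_odd_chord (hcyc : w.IsCycle) (hw : Even w.length)
    {β : G.edgeSet →₀ ℤ} (hβ : boundary β = 0) {f : G.edgeSet}
    (hf : IsOddChordOfCycle w f)
    (hsupp : ∀ e : G.edgeSet, (e : Sym2 V) ∉ w.edges → e ≠ f → β e = 0) : β f = 0 := by
  classical
  obtain ⟨σ, hσ⟩ := exists_alternating_signs hcyc hw
  let Φ : (V →₀ ℤ) →ₗ[ℤ] ℤ := Finsupp.linearCombination ℤ σ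
  have hΦ : ∀ x y, Φ (edgeVector s(x, y)) = σ x + σ y := by
    intro x y
    have : edgeVector s(x, y) = Finsupp.single x (1 : ℤ) + Finsupp.single y 1 := rfl
    simp [this, Φ]
  have hedge : ∀ e ∈ w.edges, Φ (edgeVector e) = 0 := by
    intro e he
    obtain ⟨k, hk, rfl⟩ := List.getElem_of_mem he
    rw [Walk.length_edges] at hk
    rw [Walk.getElem_edges]
    rw [hΦ, hσ k (by omega), hσ (k + 1) (by omega), pow_succ]
    ring
  have hsum : Φ (boundary β) = β f * Φ (edgeVector (f : Sym2 V)) := by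
    have h2 : boundary β = ∑ e ∈ β.support, β e • edgeVector (e : Sym2 V) :=
      Finsupp.linearCombination_apply _ _
    rw [h2, map_sum]
    simp only [map_smul, smul_eq_mul]
    refine Finset.sum_eq_single f (fun e _ hne => ?_) (fun hf => ?_)
    · by_cases he : (e : Sym2 V) ∈ w.edges
      · rw [hedge _ he, mul_zero]
      · rw [hsupp e he hne, zero_mul]
    · rw [Finsupp.notMem_support_iff.1 hf, zero_mul]
  rw [hβ, map_zero] at hsum
  obtain ⟨-, -, i, j, hij, hj, hfij, ho, -⟩ := hf
  have hpar : Even (i + j) := by grind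
  rw [hfij, hΦ, hσ i (by omega), hσ j hj.le] at hsum
  have hsq : (-1 : ℤ) ^ i = (-1) ^ j := by
    rcases Nat.even_or_odd i with h | h
    · rw [h.neg_one_pow, ((Nat.even_add.1 hpar).1 h).neg_one_pow]
    · rw [h.neg_one_pow, Odd.neg_one_pow (by grind)]
  rw [hsq, eq_comm, mul_eq_zero] at hsum
  rcases hsum with h | h
  · exact h
  · rcases neg_one_pow_eq_or ℤ j with h' | h' <;> rw [h'] at h <;> norm_num at h

end Circuit

end

end ToricGraph

theorem theorem4p15 {V : Type*} [Finite V] (G : SimpleGraph V) (hG : G.Connected)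
    (K : Type*) [Field K] (v : V) (w : G.Walk v v) (hw : Even w.length) :
    ToricGraph.IsFundamentalBinomial K w ↔
      ToricGraph.IsCircuit (ToricGraph.graphIdeal K G) (ToricGraph.walkBinomial K w) ∧
        ((∀ f : Sym2 V, ¬ ToricGraph.IsChord w f) ∨
          (w.IsCycle ∧ (∀ f : Sym2 V, ¬ ToricGraph.IsEvenChordOfCycle w f) ∧
            ∀ f g : Sym2 V, ToricGraph.IsOddChordOfCycle w f →
              ToricGraph.IsOddChordOfCycle w g → f = g)) := by
  open ToricGraph in
  constructor
  · rintro ⟨h0, hfund⟩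
    have hα : altSum w ≠ 0 := by
      rwa [walkBinomial_eq, binom_ne_zero_iff, oddExp_ne_evenExp_iff] at h0
    have hgen := hfund.generates
    have hd := hfund.disjoint hw hα
    refine ⟨hgen.isCircuit K hw hα hd, ?_⟩
    by_cases hf : ∃ f, IsChord w f
    · obtain ⟨f, hf⟩ := hf
      exact Or.inr ⟨hgen.isCycle_of_isChord hw hα hd hf, hgen.not_isEvenChordOfCycle,
        fun f g hf hg => hgen.chord_unique hf.2.1 hg.2.1⟩
    · exact Or.inl (not_exists.1 hf)
  · rintro ⟨hcirc, hno | ⟨hcyc, heven, hodd⟩⟩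
    · exact hcirc.isFundamentalBinomial hw fun _ _ _ e he => absurd he (hno e)
    · refine hcirc.isFundamentalBinomial hw fun β hβ hS e he => ?_
      have hchord : ∀ f, IsChord w f → IsOddChordOfCycle w f := fun f hf =>
        (hf.even_or_odd hcyc hw).resolve_left (heven f)
      refine eq_zero_of_unique_odd_chord hcyc hw hβ (hchord _ he) fun e' he' hne => ?_
      by_contra hne0
      exact hne (Subtype.ext (hodd _ _ (hchord _ ⟨e'.2, hS e' hne0, he'⟩) (hchord _ he)))
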